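/- All graphs are finite, simple and undirected; $d$ denotes the graph distance. Let $G$ be a connected graph with vertex set $V(G)$ and edge set $E(G)$. A vertex $w$ *strongly resolves* vertices $u,v$ if $u$ lies on a shortest $v$–$w$ path or $v$ lies on a shortest $u$–$w$ path. A set $S\subseteq V(G)$ is a *strong resolving set* if every two distinct vertices of $V(G)\setminus S$ are strongly resolved by some vertex of $S$; $\beta_S(G)$ is the minimum cardinality of a strong resolving set. For an edge $uv$ and a vertex $w$ put $d(uv,w)=\min\{d(u,w),d(v,w)\}$. A set $S\subseteq V(G)$ is a *mixed resolving set* if for every two distinct items $a,b\in V(G)\cup E(G)$ there is $w\in S$ with $d(a,w)\neq d(b,w)$; $\beta_M(G)$ is the minimum cardinality of a mixed resolving set. Let $(\beta_S-\beta_M)(n)$ be the maximum of $\beta_S(G)-\beta_M(G)$ over all connected graphs $G$ of order $n$. **Theorem.** For every integer $n\ge 7$, $$\left\lfloor \frac{n-1}{2}\right\rfloor-2\;\le\;(\beta_S-\beta_M)(n)\;\le\; n-4 .$$ -/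

import Mathlib

namespace MetricDim

variable {V : Type*}

/-- A shortest `u`-`v` path of `G`: a path whose length is the distance of its ends. -/
def IsShortestPath (G : SimpleGraph V) {u v : V} (p : G.Walk u v) : Prop :=
  p.IsPath ∧ p.length = G.dist u v

/-- The vertex `u` belongs to some shortest `v`-`w` path of `G`. -/
def OnShortestPath (G : SimpleGraph V) (u v w : V) : Prop :=
  ∃ p : G.Walk v w, IsShortestPath G p ∧ u ∈ p.support

/-- The vertex `w` strongly resolves the vertices `u` and `v`. -/
def StronglyResolves (G : SimpleGraph V) (w u v : V) : Prop :=
  OnShortestPath G u v w ∨ OnShortestPath G v u w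

/-- `S` is a strong resolving set of `G`. -/
def IsStrongResolvingSet (G : SimpleGraph V) (S : Finset V) : Prop :=
  ∀ u v : V, u ∉ S → v ∉ S → u ≠ v → ∃ w ∈ S, StronglyResolves G w u v

/-- The distance `d(xy, w) = min (d(x, w)) (d(y, w))` from an edge `xy` to a vertex `w`. -/
noncomputable def edgeDist (G : SimpleGraph V) (e : Sym2 V) (w : V) : ℕ :=
  Sym2.lift ⟨fun x y => min (G.dist x w) (G.dist y w), fun _ _ => min_comm _ _⟩ e

/-- The distance from an item of `G` (a vertex or an edge) to a vertex. -/
noncomputable def itemDist (G : SimpleGraph V) : V ⊕ G.edgeSet → V → ℕ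
  | Sum.inl v, w => G.dist v w
  | Sum.inr e, w => edgeDist G e.1 w

/-- `S` is a mixed resolving set of `G`: any two distinct items have different distances
to some vertex of `S`. -/
def IsMixedResolvingSet (G : SimpleGraph V) (S : Finset V) : Prop :=
  ∀ a b : V ⊕ G.edgeSet, a ≠ b → ∃ w ∈ S, itemDist G a w ≠ itemDist G b w

/-- The strong metric dimension: the least cardinality of a strong resolving set. For a finite
graph the infimum is over a non-empty set, since the set of all vertices strongly resolves. -/
noncomputable def strongMetricDim (G : SimpleGraph V) : ℕ :=
  sInf {k | ∃ S : Finset V, IsStrongResolvingSet G S ∧ S.card = k}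

/-- The mixed metric dimension: the least cardinality of a mixed resolving set. For a finite
connected graph the infimum is over a non-empty set, since the set of all vertices resolves. -/
noncomputable def mixedMetricDim (G : SimpleGraph V) : ℕ :=
  sInf {k | ∃ S : Finset V, IsMixedResolvingSet G S ∧ S.card = k}

/-- The values of (strong metric dimension) - (mixed metric dimension) on the connected graphs
of order `n`. -/
def strongMixedDifferences (n : ℕ) : Set ℤ :=
  {d | ∃ G : SimpleGraph (Fin n), G.Connected ∧
    d = (strongMetricDim G : ℤ) - (mixedMetricDim G : ℤ)}

end MetricDim

namespace MetricDim

/-! Upper bound: on a geodesic between two non-adjacent vertices, an end and its neighbour can both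
be left out of a strong resolving set, so a non-complete graph has β_S ≤ n - 2, while β_M ≥ 2. For a
complete graph β_S ≤ n - 1, but β_M ≥ 3.

Lower bound: the n-cycle has β_S ≥ n/2, as a strong resolving set meets every antipodal pair, and
β_M ≤ 3, as three vertices determine every position on the subdivided cycle
(`cycle_position_injective`). -/

variable {V : Type*}

/-- A function that vanishes only at `w`, changes by at most one along edges, and can be decreased
by moving to a neighbour wherever it is non-zero is the distance to `w`. -/
theorem dist_eq_of_descent {G : SimpleGraph V} {w : V} (f : V → ℕ) (hw : ∀ v, f v = 0 ↔ v = w)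
    (hlip : ∀ u v, G.Adj u v → f u ≤ f v + 1)
    (hdesc : ∀ v, f v ≠ 0 → ∃ u, G.Adj v u ∧ f u + 1 = f v) (v : V) :
    G.Reachable v w ∧ G.dist v w = f v := by
  have hwalk : ∀ k v, f v = k → ∃ p : G.Walk v w, p.length = k := by
    intro k
    induction k with
    | zero =>
      intro v hv
      obtain rfl := (hw v).1 hv
      exact ⟨.nil, rfl⟩
    | succ k ih =>
      intro v hv
      obtain ⟨u, hvu, hu⟩ := hdesc v (by omega)
      obtain ⟨p, hp⟩ := ih u (by omega)
      exact ⟨.cons hvu p, by simp [hp]⟩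
  have hle : ∀ {a b : V} (p : G.Walk a b), f a ≤ f b + p.length := by
    intro a b p
    induction p with
    | nil => simp
    | cons h p ih =>
      have := hlip _ _ h
      rw [SimpleGraph.Walk.length_cons]
      omega
  obtain ⟨p, hp⟩ := hwalk _ v rfl
  obtain ⟨q, hq⟩ := p.reachable.exists_walk_length_eq_dist
  have h1 := hle q
  have h2 := SimpleGraph.dist_le p
  have h3 := (hw w).2 rfl
  exact ⟨p.reachable, by omega⟩

theorem dist_add_dist_le_of_onShortestPath {G : SimpleGraph V} {u v w : V}
    (h : OnShortestPath G u v w) : G.dist v u + G.dist u w ≤ G.dist v w := by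
  classical
  obtain ⟨p, ⟨-, hp⟩, hu⟩ := h
  have h1 := SimpleGraph.dist_le (p.takeUntil u hu)
  have h2 := SimpleGraph.dist_le (p.dropUntil u hu)
  have h3 := congrArg SimpleGraph.Walk.length (p.take_spec hu)
  rw [SimpleGraph.Walk.length_append] at h3
  omega

/-- Of two distinct vertices at maximum distance, a strong resolving set contains one. -/
theorem IsStrongResolvingSet.mem_or_mem_of_dist_le {G : SimpleGraph V} (hG : G.Connected)
    {S : Finset V} (hS : IsStrongResolvingSet G S) {u v : V} (huv : u ≠ v)
    (hmax : ∀ a b, G.dist a b ≤ G.dist u v) : u ∈ S ∨ v ∈ S := by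
  by_contra! h
  obtain ⟨w, hw, h' | h'⟩ := hS u v h.1 h.2 huv
  · have h1 := dist_add_dist_le_of_onShortestPath h'
    have h2 := hmax v w
    rw [G.dist_comm (u := v) (v := u)] at h1
    -- A geodesic from `v` through `u` cannot continue past `u`, by maximality.
    have h3 : G.dist u w = 0 := by omega
    rw [hG.dist_eq_zero_iff] at h3
    exact h.1 (h3 ▸ hw)
  · have h1 := dist_add_dist_le_of_onShortestPath h'
    have h2 := hmax u w
    have h3 : G.dist v w = 0 := by omega
    rw [hG.dist_eq_zero_iff] at h3
    exact h.2 (h3 ▸ hw)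

/-! ### General bounds on the two dimensions -/

theorem strongMetricDim_le {G : SimpleGraph V} {S : Finset V} (hS : IsStrongResolvingSet G S) :
    strongMetricDim G ≤ S.card :=
  Nat.sInf_le ⟨S, hS, rfl⟩

theorem mixedMetricDim_le {G : SimpleGraph V} {S : Finset V} (hS : IsMixedResolvingSet G S) :
    mixedMetricDim G ≤ S.card :=
  Nat.sInf_le ⟨S, hS, rfl⟩

theorem exists_isStrongResolvingSet_card_eq [Fintype V] (G : SimpleGraph V) :
    ∃ S : Finset V, IsStrongResolvingSet G S ∧ S.card = strongMetricDim G :=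
  Nat.sInf_mem (s := {k | ∃ S : Finset V, IsStrongResolvingSet G S ∧ S.card = k})
    ⟨_, Finset.univ, fun u _ hu => absurd (Finset.mem_univ u) hu, rfl⟩

@[simp]
theorem itemDist_vertex (G : SimpleGraph V) (v w : V) :
    itemDist G (.inl v) w = G.dist v w := rfl

@[simp]
theorem itemDist_edge (G : SimpleGraph V) {x y : V} (h : s(x, y) ∈ G.edgeSet) (w : V) :
    itemDist G (.inr ⟨s(x, y), h⟩) w = min (G.dist x w) (G.dist y w) := rfl

/-- The set of all vertices is a mixed resolving set of a connected graph. -/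
theorem isMixedResolvingSet_univ [Fintype V] {G : SimpleGraph V} (hG : G.Connected) :
    IsMixedResolvingSet G Finset.univ := by
  intro a b hab
  by_contra! h
  -- An item is recovered from its zero set: one vertex, or the two ends of an edge.
  have h : ∀ w, itemDist G a w = 0 ↔ itemDist G b w = 0 := fun w => by
    rw [h w (Finset.mem_univ w)]
  have hv : ∀ v w, itemDist G (.inl v) w = 0 ↔ w = v := fun v w => by
    rw [itemDist_vertex, hG.dist_eq_zero_iff, eq_comm]
  have he : ∀ (e : G.edgeSet) w, itemDist G (.inr e) w = 0 ↔ w ∈ e.1 := by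
    rintro ⟨e, he⟩ w
    induction e using Sym2.ind with
    | _ x y =>
      rw [itemDist_edge, Nat.min_eq_zero_iff, hG.dist_eq_zero_iff, hG.dist_eq_zero_iff,
        Sym2.mem_iff, eq_comm, eq_comm (a := y)]
  have hne : ∀ (v : V) (e : G.edgeSet), ¬ ∀ w, w = v ↔ w ∈ e.1 := by
    rintro v ⟨e, he⟩ hve
    induction e using Sym2.ind with
    | _ x y =>
      have hx := (hve x).2 (Sym2.mem_mk_left x y)
      have hy := (hve y).2 (Sym2.mem_mk_right x y)
      exact (SimpleGraph.Adj.ne ((G.mem_edgeSet).1 he)) (hx.trans hy.symm)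
  rcases a with a | a <;> rcases b with b | b
  · simp only [hv] at h
    exact hab (congrArg _ ((h a).1 rfl))
  · simp only [hv, he] at h
    exact hne a b h
  · simp only [hv, he] at h
    exact hne b a fun w => (h w).symm
  · simp only [he] at h
    exact hab (congrArg _ (Subtype.ext (Sym2.ext h)))

theorem exists_isMixedResolvingSet_card_eq [Fintype V] {G : SimpleGraph V} (hG : G.Connected) :
    ∃ S : Finset V, IsMixedResolvingSet G S ∧ S.card = mixedMetricDim G :=
  Nat.sInf_mem (s := {k | ∃ S : Finset V, IsMixedResolvingSet G S ∧ S.card = k})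
    ⟨_, Finset.univ, isMixedResolvingSet_univ hG, rfl⟩

/-- A connected graph with at least two vertices has mixed metric dimension at least two. -/
theorem two_le_mixedMetricDim [Fintype V] [Nontrivial V] {G : SimpleGraph V} (hG : G.Connected) :
    2 ≤ mixedMetricDim G := by
  obtain ⟨S, hS, hcard⟩ := exists_isMixedResolvingSet_card_eq hG
  rw [← hcard]
  by_contra! hlt
  have hsub : ∃ w, ∀ x ∈ S, x = w := by
    rcases S.eq_empty_or_nonempty with rfl | ⟨w, hw⟩
    · exact ⟨Classical.arbitrary V, by simp⟩
    · exact ⟨w, fun x hx => Finset.card_le_one.1 (by omega) x hx w hw⟩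
  obtain ⟨w, hw⟩ := hsub
  obtain ⟨u, hu⟩ := hG.preconnected.exists_adj_of_nontrivial w
  -- Both `w` and an edge at `w` have distance 0 to `w`.
  obtain ⟨x, hx, hne⟩ := hS (.inl w) (.inr ⟨s(w, u), G.mem_edgeSet.2 hu⟩) (by simp)
  obtain rfl := hw x hx
  refine hne ?_
  rw [itemDist_vertex, itemDist_edge, SimpleGraph.dist_self, Nat.zero_min]

/-- Two vertices outside `S` are at distance 1 from all of `S`, so `S` misses at most one vertex. -/
theorem three_le_mixedMetricDim_top [Fintype V] (hV : 4 ≤ Fintype.card V) :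
    3 ≤ mixedMetricDim (⊤ : SimpleGraph V) := by
  classical
  have : Nonempty V := Fintype.card_pos_iff.1 (by omega)
  obtain ⟨S, hS, hcard⟩ :=
    exists_isMixedResolvingSet_card_eq (SimpleGraph.connected_top (V := V))
  rw [← hcard]
  by_contra! hlt
  have hc : 1 < Sᶜ.card := by rw [Finset.card_compl]; omega
  obtain ⟨c, hc, d, hd, hcd⟩ := Finset.one_lt_card.1 hc
  rw [Finset.mem_compl] at hc hd
  obtain ⟨x, hx, hne⟩ := hS (.inl c) (.inl d) (by simpa using hcd)
  refine hne ?_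
  have h1 : c ≠ x := fun h => hc (h ▸ hx)
  have h2 : d ≠ x := fun h => hd (h ▸ hx)
  rw [itemDist_vertex, itemDist_vertex, SimpleGraph.dist_top_of_ne h1,
    SimpleGraph.dist_top_of_ne h2]

theorem strongMetricDim_add_one_le [Fintype V] [Nonempty V] (G : SimpleGraph V) :
    strongMetricDim G + 1 ≤ Fintype.card V := by
  classical
  obtain ⟨x⟩ := ‹Nonempty V›
  have h := strongMetricDim_le (G := G) (S := {x}ᶜ) fun u v hu hv huv => by
    simp only [Finset.mem_compl, Finset.mem_singleton, not_not] at hu hv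
    exact absurd (hu.trans hv.symm) huv
  have : 0 < Fintype.card V := Fintype.card_pos_iff.2 ⟨x⟩
  rw [Finset.card_compl, Finset.card_singleton] at h
  omega

/-- A connected graph of order `n` that is not complete has strong metric dimension at most
`n - 2`. -/
theorem strongMetricDim_add_two_le [Fintype V] {G : SimpleGraph V} (hG : G.Connected)
    (hne : G ≠ ⊤) : strongMetricDim G + 2 ≤ Fintype.card V := by
  classical
  obtain ⟨u, v, huv, hadj⟩ := SimpleGraph.ne_top_iff_exists_not_adj.1 hne
  obtain ⟨p, hp, hlen⟩ := hG.exists_path_of_dist u v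
  have hnil : ¬ p.Nil := SimpleGraph.Walk.not_nil_of_ne huv
  have hu : G.Adj u p.snd := p.adj_snd hnil
  have hmem : p.snd ∈ p.support := p.getVert_mem_support 1
  set w := p.snd
  have hvw : v ≠ w := fun h => hadj (h ▸ hu)
  have hres : OnShortestPath G w u v := ⟨p, ⟨hp, hlen⟩, hmem⟩
  -- The only pair left to resolve is `u`, `w`, and the far end `v` does it; non-adjacency gives `v
  -- ≠ w`.
  have h := strongMetricDim_le (G := G) (S := {u, w}ᶜ) fun a b ha hb hab => by
    simp only [Finset.mem_compl, Finset.mem_insert, Finset.mem_singleton, not_not] at ha hb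
    refine ⟨v, by simp [huv.symm, hvw], ?_⟩
    rcases ha with rfl | rfl <;> rcases hb with rfl | rfl
    · exact absurd rfl hab
    · exact Or.inr hres
    · exact Or.inl hres
    · exact absurd rfl hab
  have hle := Finset.card_le_univ ({u, w} : Finset V)
  rw [Finset.card_compl, Finset.card_pair hu.ne] at h
  rw [Finset.card_pair hu.ne] at hle
  omega

theorem strongMetricDim_sub_mixedMetricDim_le [Fintype V] {G : SimpleGraph V}
    (hG : G.Connected) (hV : 4 ≤ Fintype.card V) :
    (strongMetricDim G : ℤ) - mixedMetricDim G ≤ (Fintype.card V : ℤ) - 4 := by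
  have : Nontrivial V := Fintype.one_lt_card_iff_nontrivial.1 (by omega)
  by_cases h : G = ⊤
  · subst h
    have h1 := three_le_mixedMetricDim_top hV
    have h2 := strongMetricDim_add_one_le (⊤ : SimpleGraph V)
    omega
  · have h1 := two_le_mixedMetricDim hG
    have h2 := strongMetricDim_add_two_le hG h
    omega

/-! ### Cycles -/

/-- The cycle on the vertices `0, 1, …, n - 1`. -/
def cycle (n : ℕ) : SimpleGraph (Fin n) where
  Adj i j := i ≠ j ∧ (i.val + 1 = j.val ∨ j.val + 1 = i.val ∨
    (i.val = 0 ∧ j.val + 1 = n) ∨ (j.val = 0 ∧ i.val + 1 = n))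
  symm := ⟨fun i j h => ⟨h.1.symm, by have := h.2; omega⟩⟩
  loopless := ⟨fun i h => h.1 rfl⟩

theorem cycle_dist {n : ℕ} (hn : 3 ≤ n) (v w : Fin n) :
    (cycle n).Reachable v w ∧
      (cycle n).dist v w = min (v.val - w.val + (w.val - v.val))
        (n - (v.val - w.val + (w.val - v.val))) := by
  refine dist_eq_of_descent (fun v : Fin n => min (v.val - w.val + (w.val - v.val))
        (n - (v.val - w.val + (w.val - v.val)))) ?_ ?_ ?_ v
  · intro v
    rw [Fin.ext_iff]
    omega
  · rintro u v ⟨-, h⟩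
    omega
  · intro v hv
    have key : ∃ k, k < n ∧ k ≠ v.val ∧ (v.val + 1 = k ∨ k + 1 = v.val ∨
        (v.val = 0 ∧ k + 1 = n) ∨ (k = 0 ∧ v.val + 1 = n)) ∧
        min (k - w.val + (w.val - k)) (n - (k - w.val + (w.val - k))) + 1 =
          min (v.val - w.val + (w.val - v.val)) (n - (v.val - w.val + (w.val - v.val))) := by
      -- `hup` says that increasing the index, possibly wrapping past `n - 1`, is a shortest way to
      -- `w`.
      by_cases hup : (v.val < w.val ∧ 2 * (w.val - v.val) ≤ n) ∨
          (w.val < v.val ∧ n < 2 * (v.val - w.val))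
      · by_cases hlast : v.val + 1 = n
        · exact ⟨0, by omega⟩
        · exact ⟨v.val + 1, by omega⟩
      · by_cases hfirst : v.val = 0
        · exact ⟨n - 1, by omega⟩
        · exact ⟨v.val - 1, by omega⟩
    obtain ⟨k, hk, hkv, hadj, hd⟩ := key
    exact ⟨⟨k, hk⟩, ⟨fun h => hkv (congrArg Fin.val h).symm, hadj⟩, hd⟩

theorem cycle_connected {n : ℕ} (hn : 3 ≤ n) : (cycle n).Connected :=
  have : Nonempty (Fin n) := ⟨⟨0, by omega⟩⟩
  ⟨fun v w => (cycle_dist hn v w).1⟩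

/-- At least half of the vertices of a cycle are needed to resolve it strongly. -/
theorem le_two_mul_strongMetricDim_cycle {n : ℕ} (hn : 3 ≤ n) :
    n ≤ 2 * strongMetricDim (cycle n) := by
  classical
  obtain ⟨S, hS, hcard⟩ := exists_isStrongResolvingSet_card_eq (cycle n)
  -- Rotation by `n / 2` sends each vertex to one at maximum distance, so `S` and its preimage under
  -- `r` cover the cycle.
  let r : Fin n → Fin n := fun i =>
    if h : i.val + n / 2 < n then ⟨i.val + n / 2, h⟩ else ⟨i.val + n / 2 - n, by omega⟩
  have hr : ∀ i, ((r i).val = i.val + n / 2 ∧ i.val + n / 2 < n) ∨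
      ((r i).val = i.val + n / 2 - n ∧ n ≤ i.val + n / 2) := by
    intro i
    by_cases h : i.val + n / 2 < n
    · exact Or.inl ⟨by simp [r, h], h⟩
    · exact Or.inr ⟨by simp [r, h], by omega⟩
  have hinj : Function.Injective r := by
    intro i j hij
    have h1 := hr i
    have h2 := hr j
    rw [hij] at h1
    exact Fin.ext (by omega)
  have hcover : ∀ i, i ∈ S ∨ r i ∈ S := by
    intro i
    have h1 := hr i
    refine hS.mem_or_mem_of_dist_le (cycle_connected hn) ?_ ?_
    · rw [Ne, Fin.ext_iff]
      omega
    · intro a b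
      rw [(cycle_dist hn a b).2, (cycle_dist hn i (r i)).2]
      omega
  have hsub : Finset.univ ⊆ S ∪ Finset.univ.filter (fun i => r i ∈ S) := fun i _ => by
    simpa using hcover i
  have h1 := (Finset.card_le_card hsub).trans (Finset.card_union_le _ _)
  have h2 : (Finset.univ.filter (fun i => r i ∈ S)).card ≤ S.card :=
    Finset.card_le_card_of_injOn r (fun i hi => by simpa using hi) hinj.injOn
  rw [Finset.card_univ, Fintype.card_fin] at h1
  omega

/-- Every edge of a cycle joins consecutive vertices, in one direction of the cycle. -/
theorem exists_eq_of_mem_cycle_edgeSet {n : ℕ} {e : Sym2 (Fin n)} (he : e ∈ (cycle n).edgeSet) :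
    ∃ x y : Fin n, e = s(x, y) ∧ (x.val + 1 = y.val ∨ (x.val + 1 = n ∧ y.val = 0)) := by
  induction e using Sym2.ind with
  | _ x y =>
    have h : _ ∧ _ := he
    rcases h.2 with h | h | h | h
    · exact ⟨x, y, rfl, Or.inl h⟩
    · exact ⟨y, x, Sym2.eq_swap, Or.inl h⟩
    · exact ⟨y, x, Sym2.eq_swap, Or.inr h.symm⟩
    · exact ⟨x, y, rfl, Or.inr h.symm⟩

/-- Vertex `i` of a cycle has position `2 * i` on the cycle subdivided once, and the edge from `i`
to the next vertex has position `2 * i + 1`; the distances to an item are read off its position. -/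
theorem exists_position_of_cycle_item {n : ℕ} (hn : 3 ≤ n) (s : Fin n ⊕ (cycle n).edgeSet) :
    ∃ p < 2 * n, (∀ w : Fin n, itemDist (cycle n) s w =
        min (p - 2 * w.val + (2 * w.val - p)) (2 * n - (p - 2 * w.val + (2 * w.val - p))) / 2) ∧
      ((∃ u : Fin n, s = .inl u ∧ p = 2 * u.val) ∨
        ∃ (x y : Fin n) (h : s(x, y) ∈ (cycle n).edgeSet), s = .inr ⟨s(x, y), h⟩ ∧
          (x.val + 1 = y.val ∨ (x.val + 1 = n ∧ y.val = 0)) ∧ p = 2 * x.val + 1) := by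
  rcases s with u | ⟨e, he⟩
  · refine ⟨2 * u.val, by omega, fun w => ?_, Or.inl ⟨u, rfl, rfl⟩⟩
    rw [itemDist_vertex, (cycle_dist hn u w).2]
    omega
  · obtain ⟨x, y, rfl, hxy⟩ := exists_eq_of_mem_cycle_edgeSet he
    refine ⟨2 * x.val + 1, by omega, fun w => ?_, Or.inr ⟨x, y, he, rfl, hxy, rfl⟩⟩
    rw [itemDist_edge, (cycle_dist hn x w).2, (cycle_dist hn y w).2]
    rcases hxy with h | ⟨h, h0⟩
    · rw [← h]
      omega
    · rw [h0]
      omega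

/-- A position on a subdivided cycle is determined by the distances to three vertices. -/
theorem cycle_position_injective {n p q : ℕ} (hn : 3 ≤ n) (hp : p < 2 * n) (hq : q < 2 * n)
    (h : ∀ w ∈ ({0, 1, n / 2 + 1} : Finset ℕ),
      min (p - 2 * w + (2 * w - p)) (2 * n - (p - 2 * w + (2 * w - p))) / 2 =
        min (q - 2 * w + (2 * w - q)) (2 * n - (q - 2 * w + (2 * w - q))) / 2) : p = q := by
  obtain ⟨m, hm⟩ : ∃ m, m = n / 2 := ⟨_, rfl⟩
  rw [← hm] at h
  have hm1 : 2 * m ≤ n := by omega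
  have hm2 : n ≤ 2 * m + 1 := by omega
  clear hm
  let D : ℕ → ℕ → ℕ := fun p w =>
    min (p - 2 * w + (2 * w - p)) (2 * n - (p - 2 * w + (2 * w - p))) / 2
  -- The distances are piecewise linear up to rounding. On each of the last three arcs, one anchor
  -- reads off `p / 2` rounded down and another `p / 2` rounded up, which fixes `p`.
  have key : ∀ p < 2 * n,
      (p = 0 ∧ D p 0 = 0 ∧ D p 1 = 1 ∧ D p (m + 1) = n - m - 1) ∨
      (p = 1 ∧ D p 0 = 0 ∧ D p 1 = 0) ∨
      (2 ≤ p ∧ p ≤ n ∧ D p 0 = p / 2 ∧ D p 1 = (p - 2) / 2 ∧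
        D p (m + 1) = (2 * m + 2 - p) / 2) ∨
      (n < p ∧ p ≤ 2 * m + 2 ∧ D p 0 = (2 * n - p) / 2 ∧ D p 1 = (p - 2) / 2 ∧
        D p (m + 1) = (2 * m + 2 - p) / 2) ∨
      (2 * m + 2 < p ∧ D p 0 = (2 * n - p) / 2 ∧ D p 1 = (2 * n + 2 - p) / 2 ∧
        D p (m + 1) = (p - 2 * m - 2) / 2) := by
    intro p hp
    dsimp only [D]
    by_cases h0 : p = 0
    · exact Or.inl (by omega)
    refine Or.inr ?_
    by_cases h1 : p = 1
    · exact Or.inl (by omega)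
    refine Or.inr ?_
    by_cases h2 : p ≤ n
    · exact Or.inl ⟨by omega, h2, by omega, by omega, by omega⟩
    refine Or.inr ?_
    by_cases h3 : p ≤ 2 * m + 2
    · exact Or.inl ⟨by omega, h3, by omega, by omega, by omega⟩
    · exact Or.inr ⟨by omega, by omega, by omega, by omega⟩
  have ha : D p 0 = D q 0 := h 0 (by simp)
  have hb : D p 1 = D q 1 := h 1 (by simp)
  have hc : D p (m + 1) = D q (m + 1) := h (m + 1) (by simp)
  have kp := key p hp
  have kq := key q hq
  clear_value D
  rcases kp with kp | kp | kp | kp | kp <;> rcases kq with kq | kq | kq | kq | kq <;> omega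

theorem mixedMetricDim_cycle_le {n : ℕ} (hn : 3 ≤ n) : mixedMetricDim (cycle n) ≤ 3 := by
  let a : Fin n := ⟨0, by omega⟩
  let b : Fin n := ⟨1, by omega⟩
  let c : Fin n := ⟨n / 2 + 1, by omega⟩
  refine (mixedMetricDim_le (S := {a, b, c}) ?_).trans Finset.card_le_three
  intro s t hst
  by_contra! h
  obtain ⟨p, hp, hps, hs⟩ := exists_position_of_cycle_item hn s
  obtain ⟨q, hq, hqt, ht⟩ := exists_position_of_cycle_item hn t
  have hpq : p = q := by
    refine cycle_position_injective hn hp hq fun w hw => ?_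
    simp only [Finset.mem_insert, Finset.mem_singleton] at hw
    rcases hw with rfl | rfl | rfl
    · exact (hps a).symm.trans ((h a (by simp)).trans (hqt a))
    · exact (hps b).symm.trans ((h b (by simp)).trans (hqt b))
    · exact (hps c).symm.trans ((h c (by simp)).trans (hqt c))
  rcases hs with ⟨u, rfl, hu⟩ | ⟨x, y, hxy, rfl, hx, hpx⟩ <;>
    rcases ht with ⟨v, rfl, hv⟩ | ⟨z, w, hzw, rfl, hz, hqz⟩
  · exact hst (congrArg _ (Fin.ext (by omega)))
  · omega
  · omega
  · obtain rfl : x = z := Fin.ext (by omega)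
    obtain rfl : y = w := Fin.ext (by omega)
    exact hst rfl

end MetricDim

open MetricDim in
theorem theorem2p3 (n : ℕ) (hn : 7 ≤ n) :
    ∃ M : ℤ, IsGreatest (MetricDim.strongMixedDifferences n) M ∧
      ⌊((n : ℚ) - 1) / 2⌋ - 2 ≤ M ∧ M ≤ (n : ℤ) - 4 := by
  have hbdd : ∀ d ∈ strongMixedDifferences n, d ≤ (n : ℤ) - 4 := by
    rintro d ⟨G, hG, rfl⟩
    simpa using strongMetricDim_sub_mixedMetricDim_le hG (by rw [Fintype.card_fin]; omega)
  have hcycle : (strongMetricDim (cycle n) : ℤ) - mixedMetricDim (cycle n) ∈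
      strongMixedDifferences n := ⟨cycle n, cycle_connected (by omega), rfl⟩
  obtain ⟨M, hM, hmax⟩ := Int.exists_greatest_of_bdd ⟨_, hbdd⟩ ⟨_, hcycle⟩
  refine ⟨M, ⟨hM, hmax⟩, ?_, hbdd M hM⟩
  have h1 := hmax _ hcycle
  have h2 := le_two_mul_strongMetricDim_cycle (n := n) (by omega)
  have h3 := mixedMetricDim_cycle_le (n := n) (by omega)
  -- This suffices because ⌈n/2⌉ - 3 = ⌊(n - 1)/2⌋ - 2.
  have h4 : 2 * ⌊((n : ℚ) - 1) / 2⌋ ≤ (n : ℤ) - 1 := by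
    have h := Int.floor_le (((n : ℚ) - 1) / 2)
    have h' : 2 * (⌊((n : ℚ) - 1) / 2⌋ : ℚ) ≤ (n : ℚ) - 1 := by linarith
    exact_mod_cast h'
  omega
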